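/- Throughout, $S\subset\mathbb R^n_+=[0,\infty)^n$ is compact and convex with $0\in S$. Write $\mathbb C^{*}=\mathbb C\setminus\{0\}$, $\operatorname{Log} z=(\log|z_1|,\dots,\log|z_n|)$ for $z\in\mathbb C^{*n}$, and $\varphi_S(\xi)=\sup_{s\in S}\langle s,\xi\rangle$. Let $H_S(z)=\varphi_S(\operatorname{Log}z)$ for $z\in\mathbb C^{*n}$ and $H_S(z)=\limsup_{\mathbb C^{*n}\ni w\to z}H_S(w)$ for $z\in\mathbb C^n\setminus\mathbb C^{*n}$. Let $\mathcal L^S(\mathbb C^n)$ be the set of plurisubharmonic functions $u:\mathbb C^n\to[-\infty,\infty)$ such that $u\le H_S+c_u$ on $\mathbb C^n$ for some real constant $c_u$. For $m\in\mathbb N=\{0,1,2,\dots\}$ let $\mathcal P^S_m(\mathbb C^n)$ be the set of polynomials $p(z)=\sum_{\alpha\in (mS)\cap\mathbb N^n}a_\alpha z^\alpha$ with complex coefficients, and let $\mathcal P^S(\mathbb C^n)=\bigcup_{m}\mathcal P^S_m(\mathbb C^n)$. For a compact set $K\subset\mathbb C^n$ put $\|p\|_K=\sup_K|p|$ and, for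 $z\in\mathbb C^n$, $$V^S_K(z)=\sup\{u(z): u\in\mathcal L^S(\mathbb C^n),\ u|_K\le 0\},$$ $$\Phi^S_K(z)=\sup_{m\ge 1}\ \sup\{|p(z)|^{1/m}: p\in\mathcal P^S_m(\mathbb C^n),\ \|p\|_K\le 1\},$$ $$\widehat K^S=\{z\in\mathbb C^n: |p(z)|\le\|p\|_K\text{ for all }p\in\mathcal P^S(\mathbb C^n)\},$$ where $V^S_K$ and $\Phi^S_K$ may take the value $+\infty$. For an ordered subset $J=(j_1,\dots,j_\ell)$ of $\{1,\dots,n\}$ (distinct entries, $0\le\ell\le n$) let $\pi_J(z)=(z_{j_1},\dots,z_{j_\ell})$, $\mathbb C^J=\{z\in\mathbb C^n: z_k=0\text{ for all }k\notin J\}$, $\mathbb R^J=\mathbb C^J\cap\mathbb R^n$, $S_J=\pi_J(S\cap\mathbb R^J)\subset\mathbb R^\ell_+$ and $K_J=\pi_J(K)\subset\mathbb C^\ell$. **Proposition.** Let $K\subset\mathbb C^n$ be a compact Reinhardt set, that is, a compact set such that $(\zeta_1z_1,\dots,\zeta_nz_n)\in K$ whenever $z\in K$ and $|\zeta_1|=\dots=|\zeta_n|=1$.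 For every ordered subset $J\subset\{1,\dots,n\}$ and every $z\in\mathbb C^J$, $$V^S_K(z)=V^{S_J}_{K_J}(\pi_J(z))\qquad\text{and}\qquad \Phi^S_K(z)=\Phi^{S_J}_{K_J}(\pi_J(z)).$$ Furthermore, $\pi_J(\widehat K^S\cap\mathbb C^J)=\widehat{K_J}^{\,S_J}$. -/

import Mathlib

open scoped Pointwise Topology

noncomputable section

namespace SiciakZakharyuta

/-- `ℂ*ⁿ`: the points of `ℂⁿ` none of whose coordinates vanishes. -/
def punctured (n : ℕ) : Set (Fin n → ℂ) := {z | ∀ i, z i ≠ 0}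

/-- `Log z = (log |z₁|, …, log |zₙ|)`; only used on `ℂ*ⁿ`. -/
def logAbs {n : ℕ} (z : Fin n → ℂ) : Fin n → ℝ := fun i => Real.log ‖z i‖

/-- The supporting function `φ_S(ξ) = sup_{s ∈ S} ⟨s, ξ⟩`, as an extended real. -/
def supportFun {n : ℕ} (S : Set (Fin n → ℝ)) (ξ : Fin n → ℝ) : EReal :=
  ⨆ s ∈ S, ((∑ i, s i * ξ i : ℝ) : EReal)

open Classical in
/-- The logarithmic supporting function `H_S`: it is `φ_S (Log z)` on `ℂ*ⁿ`, and the upper limit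
of these values along `ℂ*ⁿ` at the other points. -/
def logSupport {n : ℕ} (S : Set (Fin n → ℝ)) (z : Fin n → ℂ) : EReal :=
  if z ∈ punctured n then supportFun S (logAbs z)
  else Filter.limsup (fun w => supportFun S (logAbs w)) (𝓝[punctured n] z)

/-- The extended integral `∫₀¹ f(t) dt` of an extended real valued function, as the integral of the
positive part minus that of the negative part (meaningful when one of the two is finite, as for
upper semicontinuous `f : ℝ → [-∞, ∞)`). -/
def unitIntegral (f : ℝ → EReal) : EReal :=
  ((∫⁻ t in Set.Icc (0 : ℝ) 1, (f t).toENNReal : ENNReal) : EReal) -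
    ((∫⁻ t in Set.Icc (0 : ℝ) 1, (-f t).toENNReal : ENNReal) : EReal)

/-- Plurisubharmonic functions `ℂⁿ → [-∞, ∞)`: upper semicontinuous, with the sub-mean value
property on every circle of every complex line. The constant `-∞` is allowed. -/
structure IsPSH {n : ℕ} (u : (Fin n → ℂ) → EReal) : Prop where
  lt_top : ∀ z, u z < ⊤
  usc : UpperSemicontinuous u
  le_mean : ∀ a b : Fin n → ℂ,
    u a ≤ unitIntegral fun t => u (a + Complex.exp (2 * Real.pi * Complex.I * t) • b)

/-- The class `𝓛^S(ℂⁿ)`: plurisubharmonic `u` with `u ≤ H_S + c` for some real constant `c`. -/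
def lelongClass {n : ℕ} (S : Set (Fin n → ℝ)) : Set ((Fin n → ℂ) → EReal) :=
  {u | IsPSH u ∧ ∃ c : ℝ, ∀ z, u z ≤ logSupport S z + (c : EReal)}

/-- The Siciak-Zakharyuta function `V^S_K(z) = sup {u(z) ; u ∈ 𝓛^S(ℂⁿ), u|_K ≤ 0}`. -/
def extremalFun {n : ℕ} (S : Set (Fin n → ℝ)) (K : Set (Fin n → ℂ)) (z : Fin n → ℂ) : EReal :=
  ⨆ u ∈ {u | u ∈ lelongClass S ∧ ∀ w ∈ K, u w ≤ 0}, u z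

/-- `𝓟^S_m(ℂⁿ)`: the polynomials all of whose exponents lie in `mS`. -/
def polySpace {n : ℕ} (S : Set (Fin n → ℝ)) (m : ℕ) : Set (MvPolynomial (Fin n) ℂ) :=
  {p | ∀ α ∈ p.support, (fun i => (α i : ℝ)) ∈ (m : ℝ) • S}

/-- `‖p‖_K = sup_K |p|`, in `[0, ∞]`. -/
def supNormOn {n : ℕ} (K : Set (Fin n → ℂ)) (p : MvPolynomial (Fin n) ℂ) : ENNReal :=
  ⨆ w ∈ K, ‖MvPolynomial.eval w p‖ₑ

/-- The `m`-th Siciak function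
`Φ^S_{K,m}(z) = sup {|p(z)|^{1/m} ; p ∈ 𝓟^S_m(ℂⁿ), ‖p‖_K ≤ 1}`, for `m ≥ 1`. -/
def siciakFunOf {n : ℕ} (S : Set (Fin n → ℝ)) (K : Set (Fin n → ℂ)) (m : ℕ)
    (z : Fin n → ℂ) : ENNReal :=
  ⨆ p ∈ {p | p ∈ polySpace S m ∧ supNormOn K p ≤ 1},
    ‖MvPolynomial.eval z p‖ₑ ^ (1 / (m : ℝ))

/-- The Siciak function `Φ^S_K = sup_{m ≥ 1} Φ^S_{K,m}`. -/
def siciakFun {n : ℕ} (S : Set (Fin n → ℝ)) (K : Set (Fin n → ℂ)) (z : Fin n → ℂ) : ENNReal :=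
  ⨆ m ∈ {m : ℕ | 1 ≤ m}, siciakFunOf S K m z

/-- The `S`-hull of `K`: the `z` with `|p(z)| ≤ ‖p‖_K` for all `p ∈ 𝓟^S(ℂⁿ) = ⋃ₘ 𝓟^S_m(ℂⁿ)`. -/
def hull {n : ℕ} (S : Set (Fin n → ℝ)) (K : Set (Fin n → ℂ)) : Set (Fin n → ℂ) :=
  {z | ∀ p ∈ ⋃ m : ℕ, polySpace S m, ‖MvPolynomial.eval z p‖ₑ ≤ supNormOn K p}

/-- Reinhardt sets: invariant under coordinatewise rotation by the unit torus. -/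
def IsReinhardt {n : ℕ} (K : Set (Fin n → ℂ)) : Prop :=
  ∀ z ∈ K, ∀ ζ : Fin n → ℂ, (∀ i, ‖ζ i‖ = 1) → (fun i => ζ i * z i) ∈ K

/-- `π_J(z) = (z_{j₁}, …, z_{j_ℓ})` for `J = (j₁, …, j_ℓ)` with distinct entries. -/
def proj {n l : ℕ} {R : Type*} (J : Fin l ↪ Fin n) (z : Fin n → R) : Fin l → R :=
  fun i => z (J i)

/-- `R^J`: the points of `Rⁿ` whose coordinates outside `J` vanish (`R = ℂ` or `ℝ`). -/
def coordSubspace {n l : ℕ} (R : Type*) [Zero R] (J : Fin l ↪ Fin n) : Set (Fin n → R) :=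
  {z | ∀ k, k ∉ Set.range J → z k = 0}

/-- `S_J = π_J(S ∩ ℝ^J)`. -/
def face {n l : ℕ} (J : Fin l ↪ Fin n) (S : Set (Fin n → ℝ)) : Set (Fin l → ℝ) :=
  proj J '' (S ∩ coordSubspace ℝ J)

end SiciakZakharyuta

end

open Filter

namespace SiciakZakharyuta

variable {n l : ℕ} {J : Fin l ↪ Fin n} {S : Set (Fin n → ℝ)} {K : Set (Fin n → ℂ)}

/-! Competitors are carried both ways between `ℂⁿ` and `ℂˡ`: pulled back along `proj J`, or
restricted along the inclusion `incl J` onto `ℂ^J`; for polynomials these are `rename` and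
`killCompl`. Growth is preserved because `H_{S_J} ∘ π_J ≤ H_S`, with equality on `ℂ^J`. This is read
off `logSupport_eq`, a limit-free formula for `H_S`. For polynomials it becomes the exponent
criterion `cast_mem_smul_face_iff`. Bounds on `K` pull back trivially. For restriction, a point of
`K` with its coordinates outside `J` set to zero may leave `K`, but it is the centre of a disc whose
boundary circle lies in `K` by the Reinhardt property. The sub-mean value inequality and the maximum
principle then give the bound. -/

/-! ### The logarithmic supporting function -/

/-- The elements of `S` whose coordinates vanish wherever those of `z` do. -/
def supportedOn (S : Set (Fin n → ℝ)) (z : Fin n → ℂ) : Set (Fin n → ℝ) :=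
  {s | s ∈ S ∧ ∀ i, z i = 0 → s i = 0}

lemma continuousAt_sum_mul_log (z : Fin n → ℂ) (s : Fin n → ℝ) :
    ContinuousAt (fun x : (Fin n → ℂ) × (Fin n → ℝ) =>
      ∑ i with z i ≠ 0, x.2 i * Real.log ‖x.1 i‖) (z, s) := by
  refine tendsto_finsetSum _ fun i hi => ?_
  have hz : z i ≠ 0 := (Finset.mem_filter.mp hi).2
  have h1 : ContinuousAt (fun x : (Fin n → ℂ) × (Fin n → ℝ) => x.2 i) (z, s) := by fun_prop
  have h2 : ContinuousAt (fun x : (Fin n → ℂ) × (Fin n → ℝ) => ‖x.1 i‖) (z, s) := by fun_prop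
  exact h1.mul (h2.log (by simpa using hz))

lemma sum_mul_log_eq_sum_filter (z : Fin n → ℂ) (s : Fin n → ℝ) :
    ∑ i with z i ≠ 0, s i * Real.log ‖z i‖ = ∑ i, s i * Real.log ‖z i‖ := by
  refine Finset.sum_filter_of_ne fun i _ h hz => h ?_
  simp [hz]

/-- Near `z` the terms with `z i = 0` are nonpositive and the others continuous, which settles `s`
in `supportedOn S z`. Otherwise some `s k > 0` with `z k = 0`, and that term tends to `-∞`. -/
lemma eventually_sum_mul_log_lt (hS : ∀ s ∈ S, ∀ i, 0 ≤ s i) {z : Fin n → ℂ} {c : ℝ}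
    (hc : ∀ s ∈ supportedOn S z, ∑ i, s i * Real.log ‖z i‖ < c) {s : Fin n → ℝ} (hs : s ∈ S) :
    ∀ᶠ x : (Fin n → ℂ) × (Fin n → ℝ) in 𝓝 (z, s),
      x.1 ∈ punctured n → x.2 ∈ S → ∑ i, x.2 i * Real.log ‖x.1 i‖ < c := by
  have hcont := continuousAt_sum_mul_log z s
  have hsmall (R : ℝ) (hR : 0 < R) : ∀ᶠ x : (Fin n → ℂ) × (Fin n → ℝ) in 𝓝 (z, s),
      ∀ i, z i = 0 → ‖x.1 i‖ < R := by
    refine eventually_all.mpr fun i => ?_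
    by_cases hi : z i = 0
    · have h : ContinuousAt (fun x : (Fin n → ℂ) × (Fin n → ℝ) => ‖x.1 i‖) (z, s) := by fun_prop
      filter_upwards [h.eventually_lt_const (u := R) (by simpa [hi] using hR)] with x hx _ using hx
    · exact .of_forall fun x h => absurd h hi
  by_cases hsz : ∀ i, z i = 0 → s i = 0
  · have hlt := hc s ⟨hs, hsz⟩
    rw [← sum_mul_log_eq_sum_filter] at hlt
    filter_upwards [hcont.eventually_lt_const hlt, hsmall 1 one_pos] with x hx hx1 _ hxS
    refine lt_of_le_of_lt ?_ hx
    rw [← Finset.sum_filter_add_sum_filter_not Finset.univ (fun i => z i ≠ 0)]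
    refine add_le_of_nonpos_right (Finset.sum_nonpos fun i hi => ?_)
    have hi : z i = 0 := by simpa using hi
    exact mul_nonpos_of_nonneg_of_nonpos (hS _ hxS i)
      (Real.log_nonpos (norm_nonneg _) (hx1 i hi).le)
  · push Not at hsz
    obtain ⟨k, hzk, hsk⟩ := hsz
    have hsk : 0 < s k := lt_of_le_of_ne (hS s hs k) (Ne.symm hsk)
    set M := ∑ i with z i ≠ 0, s i * Real.log ‖z i‖ with hM
    -- The continuous part stays below `M + 1` and the `k`-th term below `-(s k / 2 * R)`; this `R`
    -- brings their sum below `c`.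
    obtain ⟨R, hR0, hR⟩ : ∃ R : ℝ, 0 ≤ R ∧ M + 1 - c ≤ s k / 2 * R := by
      refine ⟨|M + 1 - c| / (s k / 2), by positivity, ?_⟩
      rw [mul_div_cancel₀ _ (by positivity)]
      exact le_abs_self _
    have hcoord : ContinuousAt (fun x : (Fin n → ℂ) × (Fin n → ℝ) => x.2 k) (z, s) := by fun_prop
    filter_upwards [hcont.eventually_lt_const (lt_add_one M), hsmall (Real.exp (-R)) (by positivity),
      hcoord.eventually_const_lt (u := s k / 2) (half_lt_self hsk)] with x hx hx1 hxk hxp hxS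
    have hlog (i) (hi : z i = 0) : Real.log ‖x.1 i‖ < -R := by
      rw [Real.log_lt_iff_lt_exp (by simpa using hxp i)]
      exact hx1 i hi
    have hrest : ∑ i with ¬ z i ≠ 0, x.2 i * Real.log ‖x.1 i‖ ≤ x.2 k * Real.log ‖x.1 k‖ := by
      have h := Finset.single_le_sum (f := fun i => -(x.2 i * Real.log ‖x.1 i‖))
        (s := Finset.univ.filter fun i => ¬ z i ≠ 0) (fun i hi => neg_nonneg.mpr
          (mul_nonpos_of_nonneg_of_nonpos (hS _ hxS i) ?_)) (a := k) (by simpa using hzk)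
      · rw [Finset.sum_neg_distrib] at h
        exact neg_le_neg_iff.mp h
      · have := hlog i (by simpa using hi)
        linarith
    have hk : x.2 k * Real.log ‖x.1 k‖ ≤ - (s k / 2 * R) := by
      nlinarith [hlog k hzk]
    rw [← Finset.sum_filter_add_sum_filter_not Finset.univ (fun i => z i ≠ 0)]
    linarith

lemma dense_punctured (n : ℕ) : Dense (punctured n) := by
  have : punctured n = Set.univ.pi fun _ => {0}ᶜ := by
    ext z
    simp [punctured]
  rw [this]
  exact dense_pi _ fun _ _ => dense_compl_singleton 0

/-- Only exponents vanishing where `z` does survive the limit: the others drive the sum to `-∞`,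
uniformly enough by compactness of `S`. For a surviving `s` the sum converges along `ℂ*ⁿ`. -/
lemma logSupport_eq (hSc : IsCompact S) (hS : ∀ s ∈ S, ∀ i, 0 ≤ s i) (z : Fin n → ℂ) :
    logSupport S z = ⨆ s ∈ supportedOn S z, ((∑ i, s i * Real.log ‖z i‖ : ℝ) : EReal) := by
  unfold logSupport
  split_ifs with hz
  · have : supportedOn S z = S := by
      ext s
      exact ⟨fun h => h.1, fun h => ⟨h, fun i hi => absurd hi (hz i)⟩⟩
    rw [this]
    rfl
  · refine le_antisymm ?_ (iSup₂_le fun s hs => ?_)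
    · refine le_of_forall_gt_imp_ge_of_dense fun c hc => ?_
      obtain ⟨r, hr, hrc⟩ := EReal.lt_iff_exists_real_btwn.mp hc
      refine le_trans ?_ hrc.le
      have hlt : ∀ s ∈ supportedOn S z, ∑ i, s i * Real.log ‖z i‖ < r := fun s hs =>
        EReal.coe_lt_coe_iff.mp ((le_iSup₂ (f := fun s (_ : s ∈ supportedOn S z) =>
          ((∑ i, s i * Real.log ‖z i‖ : ℝ) : EReal)) s hs).trans_lt hr)
      -- Compactness of `S` turns the estimates near each `(z, s)` into one neighbourhood of `z`
      -- valid for all `s ∈ S`.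
      have hev := hSc.eventually_forall_of_forall_eventually
        (P := fun w s => w ∈ punctured n → s ∈ S → ∑ i, s i * Real.log ‖w i‖ < r)
        fun s hs => eventually_sum_mul_log_lt hS hlt hs
      refine limsup_le_of_le (h := ?_)
      rw [eventually_nhdsWithin_iff]
      filter_upwards [hev] with w hw hwp
      exact iSup₂_le fun s hs => EReal.coe_le_coe_iff.mpr (hw s hs hwp hs).le
    · have hne : (𝓝[punctured n] z).NeBot :=
        mem_closure_iff_nhdsWithin_neBot.mp (dense_punctured n z)
      have hcont : Tendsto (fun w : Fin n → ℂ => ∑ i, s i * Real.log ‖w i‖) (𝓝[punctured n] z)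
          (𝓝 (∑ i, s i * Real.log ‖z i‖)) := by
        refine tendsto_nhdsWithin_of_tendsto_nhds (tendsto_finsetSum _ fun i _ => ?_)
        by_cases hi : z i = 0
        · simp [hs.2 i hi]
        · have h : ContinuousAt (fun w : Fin n → ℂ => ‖w i‖) z :=
            (continuous_apply i).norm.continuousAt
          exact tendsto_const_nhds.mul (h.log (by simpa using hi))
      rw [← (EReal.tendsto_coe.mpr hcont).limsup_eq]
      refine limsup_le_limsup (.of_forall fun w => ?_)
      exact le_iSup₂ (f := fun s (_ : s ∈ S) =>
        ((∑ i, s i * logAbs w i : ℝ) : EReal)) s hs.1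

lemma isCompact_face (J : Fin l ↪ Fin n) (hSc : IsCompact S) : IsCompact (face J S) := by
  refine (hSc.inter_right ?_).image (continuous_pi fun i => continuous_apply (J i))
  simp only [coordSubspace, Set.ofPred_forall]
  exact isClosed_iInter fun k => isClosed_iInter fun _ =>
    isClosed_eq (continuous_apply k) continuous_const

lemma nonneg_of_mem_face (hS : ∀ s ∈ S, ∀ i, 0 ≤ s i) : ∀ s ∈ face J S, ∀ i, 0 ≤ s i := by
  rintro _ ⟨s, hs, rfl⟩ i
  exact hS s hs.1 (J i)

lemma sum_proj_mul_log {s : Fin n → ℝ} (hs : s ∈ coordSubspace ℝ J) (z : Fin n → ℂ) :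
    ∑ i, proj J s i * Real.log ‖proj J z i‖ = ∑ i, s i * Real.log ‖z i‖ :=
  Finset.sum_of_injOn J J.injective.injOn (by simp)
    (fun i _ hi => by simp [hs i (by simpa using hi)]) (fun _ _ => rfl)

lemma logSupport_face_proj_le (hSc : IsCompact S) (hS : ∀ s ∈ S, ∀ i, 0 ≤ s i)
    (z : Fin n → ℂ) : logSupport (face J S) (proj J z) ≤ logSupport S z := by
  rw [logSupport_eq (isCompact_face J hSc) (nonneg_of_mem_face hS), logSupport_eq hSc hS]
  refine iSup₂_le ?_
  rintro _ ⟨⟨s, hs, rfl⟩, hsz⟩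
  rw [sum_proj_mul_log hs.2]
  refine le_iSup₂ (f := fun s (_ : s ∈ supportedOn S z) =>
    ((∑ i, s i * Real.log ‖z i‖ : ℝ) : EReal)) s ⟨hs.1, fun i hi => ?_⟩
  by_cases hiJ : i ∈ Set.range J
  · obtain ⟨j, rfl⟩ := hiJ
    exact hsz j hi
  · exact hs.2 i hiJ

lemma logSupport_le_logSupport_face_proj (hSc : IsCompact S) (hS : ∀ s ∈ S, ∀ i, 0 ≤ s i)
    {z : Fin n → ℂ} (hz : z ∈ coordSubspace ℂ J) :
    logSupport S z ≤ logSupport (face J S) (proj J z) := by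
  rw [logSupport_eq (isCompact_face J hSc) (nonneg_of_mem_face hS), logSupport_eq hSc hS]
  refine iSup₂_le fun s hs => ?_
  -- Since `z ∈ ℂ^J`, the vanishing condition already forces `s` into `ℝ^J`.
  have hsJ : s ∈ coordSubspace ℝ J := fun k hk => hs.2 k (hz k hk)
  rw [← sum_proj_mul_log hsJ z]
  exact le_iSup₂ (f := fun s (_ : s ∈ supportedOn (face J S) (proj J z)) =>
    ((∑ i, s i * Real.log ‖proj J z i‖ : ℝ) : EReal)) (proj J s)
    ⟨⟨s, ⟨hs.1, hsJ⟩, rfl⟩, fun i hi => hs.2 _ hi⟩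

/-! ### Extension by zero -/

/-- The inclusion `ℂˡ → ℂⁿ` onto `ℂ^J`. -/
noncomputable abbrev incl (J : Fin l ↪ Fin n) : (Fin l → ℂ) →ₗ[ℂ] (Fin n → ℂ) :=
  Function.ExtendByZero.linearMap ℂ J

lemma incl_apply (ζ : Fin l → ℂ) (i : Fin l) : incl J ζ (J i) = ζ i :=
  J.injective.extend_apply _ _ _

lemma incl_apply_of_notMem (ζ : Fin l → ℂ) {k : Fin n} (hk : k ∉ Set.range J) :
    incl J ζ k = 0 :=
  Function.extend_apply' _ _ _ hk

lemma proj_incl (ζ : Fin l → ℂ) : proj J (incl J ζ) = ζ :=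
  funext (incl_apply ζ)

lemma incl_mem (ζ : Fin l → ℂ) : incl J ζ ∈ coordSubspace ℂ J :=
  fun _ => incl_apply_of_notMem ζ

lemma incl_proj {z : Fin n → ℂ} (hz : z ∈ coordSubspace ℂ J) : incl J (proj J z) = z := by
  ext k
  by_cases hk : k ∈ Set.range J
  · obtain ⟨i, rfl⟩ := hk
    exact incl_apply _ i
  · rw [incl_apply_of_notMem _ hk, hz k hk]

/-- Rotating the coordinates outside `J` of a point of `K` by a common angle stays in `K`. -/
lemma incl_proj_add_smul_mem (hK : IsReinhardt K) {z : Fin n → ℂ} (hz : z ∈ K) {c : ℂ}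
    (hc : ‖c‖ = 1) : incl J (proj J z) + c • (z - incl J (proj J z)) ∈ K := by
  classical
  convert hK z hz (fun i => if i ∈ Set.range J then 1 else c)
    (fun i => by split_ifs <;> simp [hc]) using 1
  ext k
  by_cases hk : k ∈ Set.range J
  · obtain ⟨i, rfl⟩ := hk
    simp only [Pi.add_apply, Pi.smul_apply, Pi.sub_apply, incl_apply, proj]
    simp
  · simp only [Pi.add_apply, Pi.smul_apply, Pi.sub_apply, incl_apply_of_notMem _ hk, if_neg hk]
    simp

/-! ### Plurisubharmonic functions -/

lemma IsPSH.comp_linearMap {u : (Fin n → ℂ) → EReal} (hu : IsPSH u)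
    (L : (Fin l → ℂ) →ₗ[ℂ] (Fin n → ℂ)) : IsPSH (fun ζ => u (L ζ)) where
  lt_top ζ := hu.lt_top _
  usc := hu.usc.comp L.continuous_of_finiteDimensional
  le_mean a b := by simpa only [map_add, map_smul] using hu.le_mean (L a) (L b)

/-- The positive part vanishes on the circle, so the mean is minus a nonnegative, possibly infinite,
integral. -/
lemma IsPSH.nonpos_of_circle {u : (Fin n → ℂ) → EReal} (hu : IsPSH u) {a b : Fin n → ℂ}
    (h : ∀ c : ℂ, ‖c‖ = 1 → u (a + c • b) ≤ 0) : u a ≤ 0 := by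
  refine (hu.le_mean a b).trans ?_
  have hle (t : ℝ) : u (a + Complex.exp (2 * Real.pi * Complex.I * t) • b) ≤ 0 := by
    refine h _ ?_
    have : (2 * Real.pi * Complex.I * t : ℂ) = ((2 * Real.pi * t : ℝ) : ℂ) * Complex.I := by
      push_cast
      ring
    rw [this, Complex.norm_exp_ofReal_mul_I]
  simp only [unitIntegral, EReal.toENNReal_of_nonpos (hle _), MeasureTheory.lintegral_zero]
  rw [EReal.coe_ennreal_zero, zero_sub, EReal.neg_le, neg_zero]
  exact EReal.coe_ennreal_nonneg _

lemma extremalFun_eq_face (hSc : IsCompact S) (hS : ∀ s ∈ S, ∀ i, 0 ≤ s i)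
    (hK : IsReinhardt K) {z : Fin n → ℂ} (hz : z ∈ coordSubspace ℂ J) :
    extremalFun S K z = extremalFun (face J S) (proj J '' K) (proj J z) := by
  refine le_antisymm (iSup₂_le ?_) (iSup₂_le ?_)
  · rintro u ⟨⟨hu, c, huc⟩, huK⟩
    refine le_trans (le_of_eq ?_) (le_iSup₂ (f := fun (v : (Fin l → ℂ) → EReal) (_ : v ∈
      {v | v ∈ lelongClass (face J S) ∧ ∀ w ∈ proj J '' K, v w ≤ 0}) => v (proj J z))
      (fun ζ => u (incl J ζ)) ⟨⟨hu.comp_linearMap _, c, fun ζ => (huc _).trans ?_⟩, ?_⟩)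
    · simp only [incl_proj hz]
    · gcongr
      simpa only [proj_incl] using logSupport_le_logSupport_face_proj hSc hS (incl_mem (J := J) ζ)
    · rintro _ ⟨w, hw, rfl⟩
      exact hu.nonpos_of_circle fun c hc => huK _ (incl_proj_add_smul_mem hK hw hc)
  · rintro v ⟨⟨hv, c, hvc⟩, hvK⟩
    exact le_iSup₂ (f := fun (u : (Fin n → ℂ) → EReal) (_ : u ∈
      {u | u ∈ lelongClass S ∧ ∀ w ∈ K, u w ≤ 0}) => u z) (fun w => v (proj J w))
      ⟨⟨hv.comp_linearMap (LinearMap.funLeft ℂ ℂ J), c, fun w => (hvc _).trans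
        (add_le_add_left (logSupport_face_proj_le hSc hS w) _)⟩, fun w hw => hvK _ ⟨w, hw, rfl⟩⟩

/-! ### Polynomials -/

/-- Both sides are algebra homomorphisms in `p`, so agreement on the variables suffices. -/
lemma eval_killCompl (p : MvPolynomial (Fin n) ℂ) (ζ : Fin l → ℂ) :
    MvPolynomial.eval ζ (p.killCompl J.injective) = MvPolynomial.eval (incl J ζ) p := by
  rw [MvPolynomial.killCompl, ← MvPolynomial.coe_aeval_eq_eval, ← MvPolynomial.coe_aeval_eq_eval]
  change ((MvPolynomial.aeval ζ).comp (MvPolynomial.aeval _)) p = MvPolynomial.aeval _ p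
  congr 1
  refine MvPolynomial.algHom_ext fun k => ?_
  by_cases hk : k ∈ Set.range J
  · obtain ⟨i, rfl⟩ := hk
    simp only [AlgHom.comp_apply, MvPolynomial.aeval_X, incl_apply]
    simp [Equiv.ofInjective_symm_apply]
  · rw [AlgHom.comp_apply, MvPolynomial.aeval_X, dif_neg hk, map_zero, MvPolynomial.aeval_X,
      incl_apply_of_notMem ζ hk]

lemma cast_mapDomain_mem_coordSubspace (α : Fin l →₀ ℕ) :
    (fun i => ((α.mapDomain J i : ℕ) : ℝ)) ∈ coordSubspace ℝ J := fun _ hk =>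
  Nat.cast_eq_zero.mpr (Finsupp.mapDomain_of_notMem_range _ _ hk)

lemma proj_cast_mapDomain (α : Fin l →₀ ℕ) :
    proj J (fun i => ((α.mapDomain J i : ℕ) : ℝ)) = fun i => (α i : ℝ) :=
  funext fun i => by rw [proj, Finsupp.mapDomain_apply J.injective]

lemma cast_mem_smul_face_iff (m : ℕ) (h0 : (0 : Fin n → ℝ) ∈ S) (α : Fin l →₀ ℕ) :
    (fun i => (α i : ℝ)) ∈ (m : ℝ) • face J S ↔
      (fun i => ((α.mapDomain J i : ℕ) : ℝ)) ∈ (m : ℝ) • S := by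
  have hmem := cast_mapDomain_mem_coordSubspace (J := J) α
  constructor
  · rintro ⟨_, ⟨s, hs, rfl⟩, hsα⟩
    refine ⟨s, hs.1, funext fun k => ?_⟩
    by_cases hk : k ∈ Set.range J
    · obtain ⟨i, rfl⟩ := hk
      simpa [proj, Finsupp.mapDomain_apply J.injective] using congrFun hsα i
    · have := hmem k hk
      simp only at this
      simp [this, hs.2 k hk]
  · rintro ⟨s, hs, hsα⟩
    -- For `m = 0` the given `s` need not lie in `ℝ^J`, so `0 ∈ S` serves as witness; for `m ≠ 0`
    -- one may cancel `m`.
    rcases eq_or_ne m 0 with rfl | hm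
    · refine ⟨0, ⟨0, ⟨h0, fun _ _ => rfl⟩, rfl⟩, ?_⟩
      rw [← proj_cast_mapDomain (J := J), ← hsα]
      ext i
      simp [proj]
    · refine ⟨proj J s, ⟨s, ⟨hs, fun k hk => ?_⟩, rfl⟩, ?_⟩
      · have h := congrFun hsα k
        have := hmem k hk
        simp only at this
        simpa [this, hm] using h
      · rw [← proj_cast_mapDomain (J := J), ← hsα]
        rfl

lemma killCompl_mem_polySpace (h0 : (0 : Fin n → ℝ) ∈ S) {m : ℕ}
    {p : MvPolynomial (Fin n) ℂ} (hp : p ∈ polySpace S m) :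
    p.killCompl J.injective ∈ polySpace (face J S) m := fun α hα => by
  rw [cast_mem_smul_face_iff m h0]
  refine hp _ ?_
  rwa [MvPolynomial.mem_support_iff, ← MvPolynomial.coeff_killCompl J.injective,
    ← MvPolynomial.mem_support_iff]

lemma rename_mem_polySpace (h0 : (0 : Fin n → ℝ) ∈ S) {m : ℕ}
    {q : MvPolynomial (Fin l) ℂ} (hq : q ∈ polySpace (face J S) m) :
    q.rename J ∈ polySpace S m := fun α hα => by
  classical
  rw [MvPolynomial.support_rename_of_injective J.injective, Finset.mem_image] at hα
  obtain ⟨β, hβ, rfl⟩ := hα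
  exact (cast_mem_smul_face_iff m h0 β).mp (hq β hβ)

lemma eval_rename_proj (q : MvPolynomial (Fin l) ℂ) (z : Fin n → ℂ) :
    MvPolynomial.eval z (q.rename J) = MvPolynomial.eval (proj J z) q :=
  MvPolynomial.eval_rename _ _ _

lemma enorm_eval_le_supNormOn {w : Fin n → ℂ} (hw : w ∈ K) (p : MvPolynomial (Fin n) ℂ) :
    ‖MvPolynomial.eval w p‖ₑ ≤ supNormOn K p :=
  le_iSup₂ (f := fun w (_ : w ∈ K) => ‖MvPolynomial.eval w p‖ₑ) w hw

lemma differentiable_eval_line (p : MvPolynomial (Fin n) ℂ) (a b : Fin n → ℂ) :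
    Differentiable ℂ fun c : ℂ => MvPolynomial.eval (a + c • b) p := by
  induction p using MvPolynomial.induction_on with
  | C r => simp
  | add p q hp hq =>
    simp only [map_add]
    exact hp.add hq
  | mul_X p i hp =>
    simp only [map_mul, MvPolynomial.eval_X]
    refine hp.mul ?_
    simp only [Pi.add_apply, Pi.smul_apply, smul_eq_mul]
    fun_prop

/-- Maximum principle on the unit disc for `c ↦ p(a + c b)`, evaluated at the centre. -/
lemma norm_eval_le_of_circle {p : MvPolynomial (Fin n) ℂ} {a b : Fin n → ℂ} {C : ℝ}
    (h : ∀ c : ℂ, ‖c‖ = 1 → ‖MvPolynomial.eval (a + c • b) p‖ ≤ C) :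
    ‖MvPolynomial.eval a p‖ ≤ C := by
  have := Complex.norm_le_of_forall_mem_frontier_norm_le (U := Metric.ball (0 : ℂ) 1)
    (f := fun c : ℂ => MvPolynomial.eval (a + c • b) p) (C := C) Metric.isBounded_ball
    (differentiable_eval_line p a b).diffContOnCl
    (fun c hc => h c (by simpa [frontier_ball (0 : ℂ) one_ne_zero] using hc))
    (subset_closure (Metric.mem_ball_self one_pos))
  simpa using this

lemma supNormOn_killCompl_le (hK : IsReinhardt K) (p : MvPolynomial (Fin n) ℂ) :
    supNormOn (proj J '' K) (p.killCompl J.injective) ≤ supNormOn K p := by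
  refine iSup₂_le ?_
  rintro _ ⟨w, hw, rfl⟩
  rw [eval_killCompl]
  rcases eq_or_ne (supNormOn K p) ⊤ with htop | htop
  · exact htop ▸ le_top
  · rw [← ENNReal.ofReal_toReal htop, ← ofReal_norm]
    -- The direction `b` holds the coordinates of `w` outside `J`; rotating them sweeps out a circle
    -- in `K`.
    refine ENNReal.ofReal_le_ofReal (norm_eval_le_of_circle (b := w - incl J (proj J w))
      fun c hc => ?_)
    rw [← ENNReal.ofReal_le_iff_le_toReal htop, ofReal_norm]
    exact enorm_eval_le_supNormOn (incl_proj_add_smul_mem hK hw hc) p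

lemma supNormOn_rename (q : MvPolynomial (Fin l) ℂ) :
    supNormOn K (q.rename J) = supNormOn (proj J '' K) q := by
  simp only [supNormOn, iSup_image, eval_rename_proj]

lemma siciakFunOf_eq_face (h0 : (0 : Fin n → ℝ) ∈ S) (hK : IsReinhardt K) (m : ℕ)
    {z : Fin n → ℂ} (hz : z ∈ coordSubspace ℂ J) :
    siciakFunOf S K m z = siciakFunOf (face J S) (proj J '' K) m (proj J z) := by
  refine le_antisymm (iSup₂_le ?_) (iSup₂_le ?_)
  · rintro p ⟨hp, hpK⟩
    have h := le_iSup₂ (f := fun (q : MvPolynomial (Fin l) ℂ) (_ : q ∈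
      {q | q ∈ polySpace (face J S) m ∧ supNormOn (proj J '' K) q ≤ 1}) =>
      ‖MvPolynomial.eval (proj J z) q‖ₑ ^ (1 / (m : ℝ))) (p.killCompl J.injective)
      ⟨killCompl_mem_polySpace h0 hp, (supNormOn_killCompl_le hK p).trans hpK⟩
    rwa [eval_killCompl, incl_proj hz] at h
  · rintro q ⟨hq, hqK⟩
    have h := le_iSup₂ (f := fun (p : MvPolynomial (Fin n) ℂ) (_ : p ∈
      {p | p ∈ polySpace S m ∧ supNormOn K p ≤ 1}) =>
      ‖MvPolynomial.eval z p‖ₑ ^ (1 / (m : ℝ))) (q.rename J)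
      ⟨rename_mem_polySpace h0 hq, (supNormOn_rename q).trans_le hqK⟩
    rwa [eval_rename_proj] at h

lemma proj_image_hull (h0 : (0 : Fin n → ℝ) ∈ S) (hK : IsReinhardt K) :
    proj J '' (hull S K ∩ coordSubspace ℂ J) = hull (face J S) (proj J '' K) := by
  ext ζ
  constructor
  · rintro ⟨z, ⟨hz, -⟩, rfl⟩ q hq
    obtain ⟨m, hm⟩ := Set.mem_iUnion.mp hq
    rw [← eval_rename_proj, ← supNormOn_rename]
    exact hz _ (Set.mem_iUnion.mpr ⟨m, rename_mem_polySpace h0 hm⟩)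
  · intro hζ
    refine ⟨incl J ζ, ⟨fun p hp => ?_, incl_mem ζ⟩, proj_incl ζ⟩
    obtain ⟨m, hm⟩ := Set.mem_iUnion.mp hp
    rw [← eval_killCompl]
    exact (hζ _ (Set.mem_iUnion.mpr ⟨m, killCompl_mem_polySpace h0 hm⟩)).trans
      (supNormOn_killCompl_le hK p)

end SiciakZakharyuta

theorem proposition3p5 (n l : ℕ) (J : Fin l ↪ Fin n)
    (S : Set (Fin n → ℝ)) (hS_compact : IsCompact S) (hS_convex : Convex ℝ S)
    (hS_nonneg : ∀ s ∈ S, ∀ i, 0 ≤ s i) (hS_zero : (0 : Fin n → ℝ) ∈ S)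
    (K : Set (Fin n → ℂ)) (hK_compact : IsCompact K)
    (hK_reinhardt : SiciakZakharyuta.IsReinhardt K) :
    (∀ z ∈ SiciakZakharyuta.coordSubspace ℂ J,
      SiciakZakharyuta.extremalFun S K z =
          SiciakZakharyuta.extremalFun (SiciakZakharyuta.face J S)
            (SiciakZakharyuta.proj J '' K) (SiciakZakharyuta.proj J z) ∧
        SiciakZakharyuta.siciakFun S K z =
          SiciakZakharyuta.siciakFun (SiciakZakharyuta.face J S)
            (SiciakZakharyuta.proj J '' K) (SiciakZakharyuta.proj J z)) ∧
      SiciakZakharyuta.proj J '' (SiciakZakharyuta.hull S K ∩ SiciakZakharyuta.coordSubspace ℂ J) =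
        SiciakZakharyuta.hull (SiciakZakharyuta.face J S) (SiciakZakharyuta.proj J '' K) := by
  refine ⟨fun z hz => ⟨?_, ?_⟩, ?_⟩
  · exact SiciakZakharyuta.extremalFun_eq_face hS_compact hS_nonneg hK_reinhardt hz
  · exact iSup_congr fun m => iSup_congr fun _ =>
      SiciakZakharyuta.siciakFunOf_eq_face hS_zero hK_reinhardt m hz
  · exact SiciakZakharyuta.proj_image_hull hS_zero hK_reinhardt
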